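/- Let $f$ be a probability density on $\mathbb R$ and, for $\mu\in\mathbb R$ and $\sigma>0$, let $f(x;\mu,\sigma)=\sigma^{-1}f\big((x-\mu)/\sigma\big)$ be the location-scale family it generates, so that $f=f(\cdot\,;0,1)$. Let $X\sim F_1$ have density $f(\cdot\,;\mu_1,\sigma_1)$ and $Y\sim F_2$ have density $f(\cdot\,;\mu_2,\sigma_2)$, with $\sigma_1,\sigma_2>0$. For a distribution $F$ with distribution function $F(x)$ put $\mathcal Q_p(F)=\inf\{x:F(x)\ge p\}$, and for $p\in(0,1/2)$ let $$\mathcal R_p(F_1,F_2)=\left[\frac{\mathcal Q_{1-p}(F_1)-\mathcal Q_p(F_1)}{\mathcal Q_{1-p}(F_2)-\mathcal Q_p(F_2)}\right]^2 .$$ For a functional $T$ of two distributions let $$\mathrm{PIF}_1(x_0;T,F_1,F_2)=\lim_{\epsilon\downarrow0}\frac{T\big((1-\epsilon)F_1+\epsilon\Delta_{x_0},F_2\big)-T(F_1,F_2)}{\epsilon},$$ where $\Delta_{x_0}$ is the point mass at $x_0$, let $\mathrm{PIF}_2$ be defined in the same way by contaminating $F_2$, and for sample sizes $n_1,n_2\ge1$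 and $w_i=n_i/(n_1+n_2)$ let the asymptotic variance be $$\mathrm{ASV}(T;n_1,n_2)=\frac1{w_1}E_{F_1}\big[\mathrm{PIF}_1(X;T,F_1,F_2)^2\big]+\frac1{w_2}E_{F_2}\big[\mathrm{PIF}_2(Y;T,F_1,F_2)^2\big].$$ Let $q_p$ and $q_{1-p}$ be the $p$th and $(1-p)$th quantiles of the distribution with density $f$, and let $g_0(p)=1/f(q_p)$ and $g_0(1-p)=1/f(q_{1-p})$ be the respective quantile densities. (i) Let $p\in(0,1/2)$ be such that $f$ is positive and continuous at $q_p$ and at $q_{1-p}$. Then the partial influence functions of $\mathcal R_p$ at $(F_1,F_2)$ exist for $F_1$-almost every, respectively $F_2$-almost every, $x_0$ and are square integrable, and $$\mathrm{ASV}(\mathcal R_p;n_1,n_2)=4p\,\frac{\sigma_1^4}{\sigma_2^4}\left\{\frac{g_0(p)^2+g_0(1-p)^2-p\,[g_0(p)+g_0(1-p)]^2}{w_1(1-w_1)(q_{1-p}-q_p)^2}\right\}.$$ (ii) Consequently, the choice of $p$ that minimizes the ASV does not depend on the location and scale parameters: if $S\subseteq(0,1/2)$ is a set all of whose elements satisfy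 the condition in (i), then the set of minimizers of $p\mapsto\mathrm{ASV}(\mathcal R_p;n_1,n_2)$ over $S$ is the same for all $\mu_1,\mu_2\in\mathbb R$ and $\sigma_1,\sigma_2>0$. -/

import Mathlib

open MeasureTheory ProbabilityTheory Filter Topology Set

noncomputable section

/-- The density `f(x; m, s) = s⁻¹ f((x - m) / s)` of the location-scale family generated by the
standard density `f = f(·; 0, 1)`, with location `m` and scale `s`. -/
def locScaleDensity (f : ℝ → ℝ) (m s : ℝ) (x : ℝ) : ℝ := s⁻¹ * f ((x - m) / s)

/-- The distribution on `ℝ` with density `f`. -/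
def densityLaw (f : ℝ → ℝ) : Measure ℝ := volume.withDensity (fun x => ENNReal.ofReal (f x))

/-- `f` is a probability density function on `ℝ`. -/
structure IsProbDensity (f : ℝ → ℝ) : Prop where
  measurable : Measurable f
  nonneg : ∀ x, 0 ≤ f x
  lintegral_eq_one : ∫⁻ x, ENNReal.ofReal (f x) = 1

/-- The `p`-th quantile `inf {x : F(x) ≥ p}` of the distribution `F`. -/
def quantile (p : ℝ) (F : Measure ℝ) : ℝ := sInf {x : ℝ | p ≤ cdf F x}

/-- The quantile density `1 / f(x_p)` of the distribution with density `f`. -/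
def quantileDensity (f : ℝ → ℝ) (p : ℝ) : ℝ := 1 / f (quantile p (densityLaw f))

/-- The interquantile range `x_{1-p} - x_p` of the distribution `F`. -/
def iqr (p : ℝ) (F : Measure ℝ) : ℝ := quantile (1 - p) F - quantile p F

/-- The functional `(F₁, F₂) ↦ [IQR_p(F₁) / IQR_p(F₂)]²`. -/
def sqIQRRatio (p : ℝ) (F₁ F₂ : Measure ℝ) : ℝ := (iqr p F₁ / iqr p F₂) ^ 2

/-- The contaminated distribution `(1 - ε) F + ε Δ_{x₀}`. -/
def contaminate (F : Measure ℝ) (x₀ ε : ℝ) : Measure ℝ :=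
  ENNReal.ofReal (1 - ε) • F + ENNReal.ofReal ε • Measure.dirac x₀

/-- Difference quotient of the functional `T` when the first population is contaminated. -/
def contamQuot₁ (T : Measure ℝ → Measure ℝ → ℝ) (F₁ F₂ : Measure ℝ) (x₀ ε : ℝ) : ℝ :=
  (T (contaminate F₁ x₀ ε) F₂ - T F₁ F₂) / ε

/-- Difference quotient of the functional `T` when the second population is contaminated. -/
def contamQuot₂ (T : Measure ℝ → Measure ℝ → ℝ) (F₁ F₂ : Measure ℝ) (x₀ ε : ℝ) : ℝ :=
  (T F₁ (contaminate F₂ x₀ ε) - T F₁ F₂) / ε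

/-- First partial influence function: the limit of the difference quotient as `ε ↓ 0`. -/
def pif₁ (T : Measure ℝ → Measure ℝ → ℝ) (F₁ F₂ : Measure ℝ) (x₀ : ℝ) : ℝ :=
  limUnder (𝓝[>] (0 : ℝ)) (contamQuot₁ T F₁ F₂ x₀)

/-- Second partial influence function: the limit of the difference quotient as `ε ↓ 0`. -/
def pif₂ (T : Measure ℝ → Measure ℝ → ℝ) (F₁ F₂ : Measure ℝ) (x₀ : ℝ) : ℝ :=
  limUnder (𝓝[>] (0 : ℝ)) (contamQuot₂ T F₁ F₂ x₀)

/-- The asymptotic variance `E_{F₁}[PIF₁²] / w₁ + E_{F₂}[PIF₂²] / w₂` of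
`√(n₁ + n₂) T(F_{n₁}, F_{n₂})`, with `wᵢ = nᵢ / (n₁ + n₂)`. -/
def asv (T : Measure ℝ → Measure ℝ → ℝ) (F₁ F₂ : Measure ℝ) (n₁ n₂ : ℕ) : ℝ :=
  1 / ((n₁ : ℝ) / (n₁ + n₂)) * (∫ x, pif₁ T F₁ F₂ x ^ 2 ∂F₁) +
    1 / ((n₂ : ℝ) / (n₁ + n₂)) * (∫ x, pif₂ T F₁ F₂ x ^ 2 ∂F₂)

/-- The quantities entering the asymptotic variance are meaningful: both partial influence
functions exist as limits for almost every contaminant, and they are square integrable. -/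
structure HasASV (T : Measure ℝ → Measure ℝ → ℝ) (F₁ F₂ : Measure ℝ) : Prop where
  exists_pif₁ : ∀ᵐ x ∂F₁, ∃ v, Tendsto (contamQuot₁ T F₁ F₂ x) (𝓝[>] (0 : ℝ)) (𝓝 v)
  exists_pif₂ : ∀ᵐ x ∂F₂, ∃ v, Tendsto (contamQuot₂ T F₁ F₂ x) (𝓝[>] (0 : ℝ)) (𝓝 v)
  memLp_pif₁ : MemLp (pif₁ T F₁ F₂) 2 F₁
  memLp_pif₂ : MemLp (pif₂ T F₁ F₂) 2 F₂

/-- The density `f` is positive and continuous at the `p`-th quantile of its distribution. -/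
def RegularAtQuantile (f : ℝ → ℝ) (p : ℝ) : Prop :=
  0 < f (quantile p (densityLaw f)) ∧ ContinuousAt f (quantile p (densityLaw f))

end

/-!
At a quantile `a = q_p` where the density is positive and continuous, the distribution function
`G` is differentiable with `G a = p` and `G' a = f a`. Contamination by a point mass at `x₀`
replaces `G` by `(1 - ε) G + ε 1{x₀ ≤ ·}`. For `x₀ ≠ a`, the value of this function at `a + c ε` is
`p + ε (c f(a) - (p - 1{x₀ ≤ a})) + o(ε)`, so the contaminated quantile eventually lies to the left
of `a + c ε` when `c` exceeds `(p - 1{x₀ ≤ a}) / f(a)` and to the right when `c` is smaller; that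
number is therefore the influence function of the quantile
(`hasDerivWithinAt_quantile_contaminate`). The excluded contaminants `x₀ = a` form a null set.

The partial influence functions of the squared ratio follow by the chain rule: each is a constant
multiple of the influence function of the interquantile range, whose second moment
(`integral_iqrInfluence_sq`) involves only the means `p` and `1 - p` of two nested indicators.

A member of the location-scale family is the image of the standard law under `y ↦ m + s y`, so
quantiles transform affinely and quantile densities and interquantile ranges scale by `s`. The
scales contribute only the factor `σ₁⁴ / σ₂⁴` to the asymptotic variance
(`asv_sqIQRRatio_locScale`). This factor is positive and free of `p`, hence does not affect the
minimizers.
-/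

noncomputable section

/-! ### Quantiles -/

theorem quantile_le {μ : Measure ℝ} {p x : ℝ} (hp : 0 < p) (h : p ≤ cdf μ x) :
    quantile p μ ≤ x := by
  refine csInf_le ?_ h
  obtain ⟨b, hb⟩ := ((tendsto_cdf_atBot μ).eventually (gt_mem_nhds hp)).exists
  refine ⟨b, fun y hy => ?_⟩
  by_contra! hyb
  exact absurd (hy.trans (monotone_cdf μ hyb.le)) (not_le.2 hb)

theorem le_quantile {μ : Measure ℝ} {p x : ℝ} (hp : p < 1) (h : ∀ y, p ≤ cdf μ y → x ≤ y) :
    x ≤ quantile p μ := by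
  obtain ⟨b, hb⟩ := ((tendsto_cdf_atTop μ).eventually (lt_mem_nhds hp)).exists
  exact le_csInf ⟨b, hb.le⟩ h

theorem le_quantile_of_cdf_lt {μ : Measure ℝ} {p x : ℝ} (hp : p < 1) (h : cdf μ x < p) :
    x ≤ quantile p μ := by
  refine le_quantile hp fun y hy => ?_
  by_contra! hyx
  exact absurd (hy.trans (monotone_cdf μ hyx.le)) (not_le.2 h)

theorem cdf_quantile {μ : Measure ℝ} {p : ℝ} (hp₀ : 0 < p) (hp₁ : p < 1)
    (hc : ContinuousAt (cdf μ) (quantile p μ)) : cdf μ (quantile p μ) = p := by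
  refine le_antisymm ?_ ?_
  · by_contra! h
    obtain ⟨x, hx, hxq⟩ := ((hc.tendsto.mono_left nhdsWithin_le_nhds).eventually
      (lt_mem_nhds h) |>.and (self_mem_nhdsWithin (s := Iio (quantile p μ)))).exists
    exact absurd (quantile_le hp₀ hx.le) (not_le.2 hxq)
  · by_contra! h
    obtain ⟨x, hx, hxq⟩ := ((hc.tendsto.mono_left nhdsWithin_le_nhds).eventually
      (gt_mem_nhds h) |>.and (self_mem_nhdsWithin (s := Ioi (quantile p μ)))).exists
    exact absurd (le_quantile_of_cdf_lt hp₁ hx) (not_le.2 hxq)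

/-! ### Distributions with a density -/

namespace IsProbDensity

variable {f : ℝ → ℝ}

theorem isProbabilityMeasure (hf : IsProbDensity f) : IsProbabilityMeasure (densityLaw f) :=
  ⟨by rw [densityLaw, withDensity_apply _ MeasurableSet.univ, Measure.restrict_univ,
    hf.lintegral_eq_one]⟩

theorem integrable (hf : IsProbDensity f) : Integrable f := by
  refine ⟨hf.measurable.aestronglyMeasurable, ?_⟩
  rw [hasFiniteIntegral_iff_ofReal (Eventually.of_forall hf.nonneg), hf.lintegral_eq_one]
  exact ENNReal.one_lt_top

theorem cdf_eq_integral (hf : IsProbDensity f) (x : ℝ) :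
    cdf (densityLaw f) x = ∫ t in Iic x, f t := by
  have := hf.isProbabilityMeasure
  rw [cdf_eq_real, measureReal_def, densityLaw, withDensity_apply _ measurableSet_Iic,
    integral_eq_lintegral_of_nonneg_ae (Eventually.of_forall hf.nonneg)
      hf.measurable.aestronglyMeasurable]

/-- A density is the derivative of the distribution function wherever it is continuous. -/
theorem hasDerivAt_cdf (hf : IsProbDensity f) {a : ℝ} (ha : ContinuousAt f a) :
    HasDerivAt (cdf (densityLaw f)) (f a) a := by
  have h : (cdf (densityLaw f) : ℝ → ℝ) =
      fun x => cdf (densityLaw f) a + ∫ t in a..x, f t := by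
    funext x
    rw [hf.cdf_eq_integral, hf.cdf_eq_integral, intervalIntegral.integral_Iic_sub_Iic
      hf.integrable.integrableOn hf.integrable.integrableOn |>.symm]
    ring
  rw [h]
  exact (intervalIntegral.integral_hasDerivAt_right hf.integrable.intervalIntegrable
    hf.measurable.stronglyMeasurable.stronglyMeasurableAtFilter ha).const_add _

theorem cdf_quantile_eq (hf : IsProbDensity f) {p : ℝ} (hp₀ : 0 < p) (hp₁ : p < 1)
    (hr : RegularAtQuantile f p) :
    cdf (densityLaw f) (quantile p (densityLaw f)) = p :=
  cdf_quantile hp₀ hp₁ (hf.hasDerivAt_cdf hr.2).continuousAt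

theorem quantile_lt_quantile_one_sub (hf : IsProbDensity f) {p : ℝ} (hp : p ∈ Ioo (0 : ℝ) (1 / 2))
    (hr : RegularAtQuantile f p) (hr' : RegularAtQuantile f (1 - p)) :
    quantile p (densityLaw f) < quantile (1 - p) (densityLaw f) := by
  by_contra! h
  have h₁ := monotone_cdf (densityLaw f) h
  rw [hf.cdf_quantile_eq hp.1 (by linarith [hp.2]) hr,
    hf.cdf_quantile_eq (by linarith [hp.2]) (by linarith [hp.1]) hr'] at h₁
  linarith [hp.2]

end IsProbDensity

/-! ### Influence function of a quantile -/

theorem contaminate_zero (F : Measure ℝ) (x₀ : ℝ) : contaminate F x₀ 0 = F := by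
  simp [contaminate]

theorem cdf_contaminate {F : Measure ℝ} [IsProbabilityMeasure F] {ε : ℝ} (h₀ : 0 ≤ ε) (h₁ : ε ≤ 1)
    (x₀ x : ℝ) :
    cdf (contaminate F x₀ ε) x = (1 - ε) * cdf F x + ε * (Iic x).indicator 1 x₀ := by
  have h₂ : 0 ≤ 1 - ε := sub_nonneg.2 h₁
  have : IsProbabilityMeasure (contaminate F x₀ ε) := ⟨by
    simp [contaminate, ← ENNReal.ofReal_add h₂ h₀]⟩
  rw [cdf_eq_real, cdf_eq_real, contaminate,
    measureReal_add_apply (ENNReal.mul_ne_top ENNReal.ofReal_ne_top (measure_ne_top _ _))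
      (ENNReal.mul_ne_top ENNReal.ofReal_ne_top (measure_ne_top _ _)),
    measureReal_ennreal_smul_apply, measureReal_ennreal_smul_apply, ENNReal.toReal_ofReal h₂, ENNReal.toReal_ofReal h₀]
  congr 2
  by_cases hx : x₀ ≤ x <;> simp [measureReal_def, hx]

/-- The influence function `(p - 1{x ≤ q_p}) / f(q_p)` of the `p`-th quantile at the distribution
with density `f`. -/
def quantileInfluence (f : ℝ → ℝ) (p x : ℝ) : ℝ :=
  (p - (Iic (quantile p (densityLaw f))).indicator 1 x) * quantileDensity f p

theorem eventually_lt_of_hasDerivAt_pos {h : ℝ → ℝ} {h' : ℝ} (hd : HasDerivAt h h' 0)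
    (hpos : 0 < h') : ∀ᶠ ε in 𝓝[>] (0 : ℝ), h 0 < h ε := by
  have hs := (hasDerivWithinAt_iff_tendsto_slope' (by simp)).1 (hd.hasDerivWithinAt (s := Ioi 0))
  filter_upwards [hs.eventually (lt_mem_nhds hpos), self_mem_nhdsWithin] with ε hε hε₀
  rw [slope_def_field, sub_zero] at hε
  exact sub_pos.1 ((div_pos_iff_of_pos_right hε₀).1 hε)

/-- A contaminating point other than the quantile keeps its side of `a + c ε` for small `ε`. -/
theorem eventually_indicator_Iic_eq {x₀ a : ℝ} (hx : x₀ ≠ a) (c : ℝ) :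
    ∀ᶠ ε in 𝓝[>] (0 : ℝ),
      (Iic (a + c * ε)).indicator (1 : ℝ → ℝ) x₀ = (Iic a).indicator 1 x₀ := by
  have ht : Tendsto (fun ε : ℝ => a + c * ε) (𝓝[>] 0) (𝓝 a) := by
    have : Continuous fun ε : ℝ => a + c * ε := by fun_prop
    simpa using (this.tendsto 0).mono_left nhdsWithin_le_nhds
  rcases hx.lt_or_gt with h | h
  · filter_upwards [ht.eventually (lt_mem_nhds h)] with ε hε
    simp [hε.le, h.le]
  · filter_upwards [ht.eventually (gt_mem_nhds h)] with ε hε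
    simp [hε, h]

/-- The distribution function of the contaminated law, followed along the line `a + c ε` that
leaves the quantile `a` with slope `c`, moves at the rate `f(a) (c - IF)`: the line overtakes the
contaminated quantile exactly if its slope exceeds the influence function. -/
theorem hasDerivWithinAt_quantile_contaminate {f : ℝ → ℝ} (hf : IsProbDensity f) {p : ℝ}
    (hp₀ : 0 < p) (hp₁ : p < 1) (hr : RegularAtQuantile f p) {x₀ : ℝ}
    (hx : x₀ ≠ quantile p (densityLaw f)) :
    HasDerivWithinAt (fun ε => quantile p (contaminate (densityLaw f) x₀ ε))
      (quantileInfluence f p x₀) (Ioi 0) 0 := by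
  have := hf.isProbabilityMeasure
  have hG := hf.hasDerivAt_cdf hr.2
  have hGa := hf.cdf_quantile_eq hp₀ hp₁ hr
  have hfa := hr.1
  set a := quantile p (densityLaw f) with ha
  set δ : ℝ := (Iic a).indicator 1 x₀ with hδ
  have hv : quantileInfluence f p x₀ = (p - δ) / f a := by
    rw [quantileInfluence, quantileDensity, ← ha, ← hδ]; ring
  have hD (c : ℝ) : HasDerivAt
      (fun ε => (1 - ε) * cdf (densityLaw f) (a + c * ε) + ε * δ) (f a * c - (p - δ)) 0 := by
    have h₁ : HasDerivAt (fun ε : ℝ => a + c * ε) c 0 := by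
      simpa using ((hasDerivAt_id (0 : ℝ)).const_mul c).const_add a
    have h₂ : HasDerivAt (fun ε : ℝ => cdf (densityLaw f) (a + c * ε)) (f a * c) 0 :=
      HasDerivAt.comp (0 : ℝ) (by simpa using hG) h₁
    have h₃ := (((hasDerivAt_id (0 : ℝ)).const_sub 1).mul h₂).add
      ((hasDerivAt_id (0 : ℝ)).mul_const δ)
    refine h₃.congr_deriv ?_
    simp [hGa]
    ring
  have hsmall : ∀ᶠ ε in 𝓝[>] (0 : ℝ), ε < 1 :=
    (gt_mem_nhds one_pos).filter_mono nhdsWithin_le_nhds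
  rw [hasDerivWithinAt_iff_tendsto_slope' (by simp), hv]
  refine tendsto_order.2 ⟨fun c' hc' => ?_, fun c' hc' => ?_⟩
  · obtain ⟨c, hc'c, hc⟩ := exists_between hc'
    have hpos : 0 < -(f a * c - (p - δ)) := by
      rw [lt_div_iff₀ hfa] at hc; linarith
    filter_upwards [eventually_lt_of_hasDerivAt_pos (hD c).neg hpos,
      eventually_indicator_Iic_eq hx c, self_mem_nhdsWithin, hsmall] with ε hε hi (hε₀ : 0 < ε) hε₁
    have hq : a + c * ε ≤ quantile p (contaminate (densityLaw f) x₀ ε) := by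
      refine le_quantile_of_cdf_lt hp₁ ?_
      rw [cdf_contaminate hε₀.le hε₁.le, hi]
      simp [hGa] at hε
      linarith
    refine hc'c.trans_le ?_
    rw [slope_def_field, contaminate_zero, sub_zero, le_div_iff₀ hε₀]
    linarith
  · obtain ⟨c, hc, hcc'⟩ := exists_between hc'
    have hpos : 0 < f a * c - (p - δ) := by
      rw [div_lt_iff₀ hfa] at hc; linarith
    filter_upwards [eventually_lt_of_hasDerivAt_pos (hD c) hpos,
      eventually_indicator_Iic_eq hx c, self_mem_nhdsWithin, hsmall] with ε hε hi (hε₀ : 0 < ε) hε₁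
    have hq : quantile p (contaminate (densityLaw f) x₀ ε) ≤ a + c * ε := by
      refine quantile_le hp₀ ?_
      rw [cdf_contaminate hε₀.le hε₁.le, hi]
      simp [hGa] at hε
      linarith
    refine lt_of_le_of_lt ?_ hcc'
    rw [slope_def_field, contaminate_zero, sub_zero, div_le_iff₀ hε₀]
    linarith

/-! ### Influence function of the interquantile range -/

/-- The influence function of the interquantile range at the distribution with density `f`. -/
def iqrInfluence (f : ℝ → ℝ) (p x : ℝ) : ℝ :=
  quantileInfluence f (1 - p) x - quantileInfluence f p x

/-- Closed form of the variance of the influence function of the interquantile range; see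
`integral_iqrInfluence_sq`. -/
def iqrVariance (f : ℝ → ℝ) (p : ℝ) : ℝ :=
  p * (quantileDensity f p ^ 2 + quantileDensity f (1 - p) ^ 2
    - p * (quantileDensity f p + quantileDensity f (1 - p)) ^ 2)

section IQR

variable {f : ℝ → ℝ} {p : ℝ}

theorem ae_ne_densityLaw (f : ℝ → ℝ) (a : ℝ) : ∀ᵐ x ∂(densityLaw f), x ≠ a :=
  (withDensity_absolutelyContinuous _ _).ae_le (Measure.ae_ne volume a)

theorem ae_hasDerivWithinAt_iqr (hf : IsProbDensity f) (hp : p ∈ Ioo (0 : ℝ) (1 / 2))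
    (hr : RegularAtQuantile f p) (hr' : RegularAtQuantile f (1 - p)) :
    ∀ᵐ x ∂(densityLaw f), HasDerivWithinAt (fun ε => iqr p (contaminate (densityLaw f) x ε))
      (iqrInfluence f p x) (Ioi 0) 0 := by
  filter_upwards [ae_ne_densityLaw f (quantile p (densityLaw f)),
    ae_ne_densityLaw f (quantile (1 - p) (densityLaw f))] with x hx hx'
  exact (hasDerivWithinAt_quantile_contaminate hf (by linarith [hp.2]) (by linarith [hp.1])
    hr' hx').sub (hasDerivWithinAt_quantile_contaminate hf hp.1 (by linarith [hp.2]) hr hx)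

theorem memLp_iqrInfluence (hf : IsProbDensity f) (p : ℝ) :
    MemLp (iqrInfluence f p) 2 (densityLaw f) := by
  have := hf.isProbabilityMeasure
  have h (q : ℝ) : MemLp (quantileInfluence f q) 2 (densityLaw f) :=
    ((memLp_const q).sub (memLp_indicator_const 2 measurableSet_Iic (1 : ℝ)
      (Or.inr (measure_ne_top _ _)))).mul_const _
  exact (h _).sub (h _)

theorem integral_iqrInfluence_sq (hf : IsProbDensity f) (hp : p ∈ Ioo (0 : ℝ) (1 / 2))
    (hr : RegularAtQuantile f p) (hr' : RegularAtQuantile f (1 - p)) :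
    ∫ x, iqrInfluence f p x ^ 2 ∂(densityLaw f) = iqrVariance f p := by
  have := hf.isProbabilityMeasure
  have hlt := hf.quantile_lt_quantile_one_sub hp hr hr'
  have hGa := hf.cdf_quantile_eq hp.1 (by linarith [hp.2]) hr
  have hGb := hf.cdf_quantile_eq (by linarith [hp.2]) (by linarith [hp.1]) hr'
  set a := quantile p (densityLaw f) with ha
  set b := quantile (1 - p) (densityLaw f) with hb
  set α := quantileDensity f p with hα
  set β := quantileDensity f (1 - p) with hβ
  set κ := (1 - p) * β - p * α with hκ
  -- The square is affine in the two indicators, as they are idempotent and `{x ≤ a} ⊆ {x ≤ b}`.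
  have hsq : (fun x => iqrInfluence f p x ^ 2) = fun x =>
      κ ^ 2 + ((α ^ 2 + 2 * κ * α - 2 * α * β) * (Iic a).indicator 1 x
        + (β ^ 2 - 2 * κ * β) * (Iic b).indicator 1 x) := by
    funext x
    rw [iqrInfluence, quantileInfluence, quantileInfluence, ← ha, ← hb, ← hα, ← hβ, hκ]
    by_cases h₁ : x ≤ a
    · have h₂ : x ≤ b := h₁.trans hlt.le
      simp only [indicator, mem_Iic, h₁, h₂, if_true, Pi.one_apply]; ring
    · by_cases h₂ : x ≤ b <;>
      · simp only [indicator, mem_Iic, h₁, h₂, if_true, if_false, Pi.one_apply]; ring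
  have hi (c : ℝ) : Integrable ((Iic c).indicator (1 : ℝ → ℝ)) (densityLaw f) :=
    (integrable_const (1 : ℝ)).indicator measurableSet_Iic
  have hm (c : ℝ) : ∫ x, (Iic c).indicator (1 : ℝ → ℝ) x ∂(densityLaw f)
      = cdf (densityLaw f) c := by
    rw [integral_indicator_one measurableSet_Iic, cdf_eq_real]
  have hab : Integrable (fun x => (α ^ 2 + 2 * κ * α - 2 * α * β) * (Iic a).indicator 1 x
      + (β ^ 2 - 2 * κ * β) * (Iic b).indicator 1 x) (densityLaw f) :=
    ((hi a).const_mul _).add ((hi b).const_mul _)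
  rw [hsq, integral_add (integrable_const _) hab, integral_add ((hi a).const_mul _) ((hi b).const_mul _), integral_const_mul,
    integral_const_mul, hm, hm, hGa, hGb, iqrVariance, ← hα, ← hβ, hκ]
  simp
  ring

end IQR

/-! ### Partial influence functions of the squared ratio -/

section Ratio

variable {f g : ℝ → ℝ} {p : ℝ}

theorem ae_tendsto_contamQuot₁ (hf : IsProbDensity f) (hp : p ∈ Ioo (0 : ℝ) (1 / 2))
    (hr : RegularAtQuantile f p) (hr' : RegularAtQuantile f (1 - p)) (F₂ : Measure ℝ) :
    ∀ᵐ x ∂(densityLaw f), Tendsto (contamQuot₁ (sqIQRRatio p) (densityLaw f) F₂ x) (𝓝[>] 0)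
      (𝓝 (2 * iqr p (densityLaw f) / iqr p F₂ ^ 2 * iqrInfluence f p x)) := by
  filter_upwards [ae_hasDerivWithinAt_iqr hf hp hr hr'] with x hx
  have h : HasDerivWithinAt (fun ε => sqIQRRatio p (contaminate (densityLaw f) x ε) F₂)
      (2 * iqr p (densityLaw f) / iqr p F₂ ^ 2 * iqrInfluence f p x) (Ioi 0) 0 := by
    refine ((hx.div_const (iqr p F₂)).pow 2).congr_deriv ?_
    rw [contaminate_zero]
    push_cast
    ring
  refine ((hasDerivWithinAt_iff_tendsto_slope' (by simp)).1 h).congr fun ε => ?_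
  rw [slope_def_field, contaminate_zero, sub_zero, contamQuot₁]

theorem ae_tendsto_contamQuot₂ (hg : IsProbDensity g) (hp : p ∈ Ioo (0 : ℝ) (1 / 2))
    (hr : RegularAtQuantile g p) (hr' : RegularAtQuantile g (1 - p)) (F₁ : Measure ℝ) :
    ∀ᵐ x ∂(densityLaw g), Tendsto (contamQuot₂ (sqIQRRatio p) F₁ (densityLaw g) x) (𝓝[>] 0)
      (𝓝 (-(2 * iqr p F₁ ^ 2 / iqr p (densityLaw g) ^ 3) * iqrInfluence g p x)) := by
  have hne : iqr p (densityLaw g) ≠ 0 :=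
    (sub_pos.2 (hg.quantile_lt_quantile_one_sub hp hr hr')).ne'
  filter_upwards [ae_hasDerivWithinAt_iqr hg hp hr hr'] with x hx
  have h : HasDerivWithinAt (fun ε => sqIQRRatio p F₁ (contaminate (densityLaw g) x ε))
      (-(2 * iqr p F₁ ^ 2 / iqr p (densityLaw g) ^ 3) * iqrInfluence g p x) (Ioi 0) 0 := by
    refine (((hasDerivWithinAt_const (0 : ℝ) (Ioi 0) (iqr p F₁)).div hx
      (by rwa [contaminate_zero])).pow 2).congr_deriv ?_
    simp only [Pi.div_apply, contaminate_zero]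
    push_cast
    field_simp
    ring
  refine ((hasDerivWithinAt_iff_tendsto_slope' (by simp)).1 h).congr fun ε => ?_
  rw [slope_def_field, contaminate_zero, sub_zero, contamQuot₂]

theorem hasASV_sqIQRRatio (hf : IsProbDensity f) (hg : IsProbDensity g)
    (hp : p ∈ Ioo (0 : ℝ) (1 / 2))
    (hfr : RegularAtQuantile f p) (hfr' : RegularAtQuantile f (1 - p))
    (hgr : RegularAtQuantile g p) (hgr' : RegularAtQuantile g (1 - p)) :
    HasASV (sqIQRRatio p) (densityLaw f) (densityLaw g) where
  exists_pif₁ := (ae_tendsto_contamQuot₁ hf hp hfr hfr' _).mono fun _ h => ⟨_, h⟩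
  exists_pif₂ := (ae_tendsto_contamQuot₂ hg hp hgr hgr' _).mono fun _ h => ⟨_, h⟩
  memLp_pif₁ := ((memLp_iqrInfluence hf p).const_mul _).ae_eq
    ((ae_tendsto_contamQuot₁ hf hp hfr hfr' _).mono fun _ h => h.limUnder_eq.symm)
  memLp_pif₂ := ((memLp_iqrInfluence hg p).const_mul _).ae_eq
    ((ae_tendsto_contamQuot₂ hg hp hgr hgr' _).mono fun _ h => h.limUnder_eq.symm)

theorem asv_sqIQRRatio (hf : IsProbDensity f) (hg : IsProbDensity g)
    (hp : p ∈ Ioo (0 : ℝ) (1 / 2))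
    (hfr : RegularAtQuantile f p) (hfr' : RegularAtQuantile f (1 - p))
    (hgr : RegularAtQuantile g p) (hgr' : RegularAtQuantile g (1 - p)) (n₁ n₂ : ℕ) :
    asv (sqIQRRatio p) (densityLaw f) (densityLaw g) n₁ n₂ =
      1 / ((n₁ : ℝ) / (n₁ + n₂)) *
        ((2 * iqr p (densityLaw f) / iqr p (densityLaw g) ^ 2) ^ 2 * iqrVariance f p) +
      1 / ((n₂ : ℝ) / (n₁ + n₂)) *
        ((2 * iqr p (densityLaw f) ^ 2 / iqr p (densityLaw g) ^ 3) ^ 2 * iqrVariance g p) := by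
  have h₁ : (fun x => pif₁ (sqIQRRatio p) (densityLaw f) (densityLaw g) x ^ 2)
      =ᵐ[densityLaw f] fun x => (2 * iqr p (densityLaw f) / iqr p (densityLaw g) ^ 2) ^ 2
        * iqrInfluence f p x ^ 2 :=
    (ae_tendsto_contamQuot₁ hf hp hfr hfr' (densityLaw g)).mono fun x h => by
      simp only [pif₁, h.limUnder_eq, mul_pow]
  have h₂ : (fun x => pif₂ (sqIQRRatio p) (densityLaw f) (densityLaw g) x ^ 2)
      =ᵐ[densityLaw g] fun x => (2 * iqr p (densityLaw f) ^ 2 / iqr p (densityLaw g) ^ 3) ^ 2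
        * iqrInfluence g p x ^ 2 :=
    (ae_tendsto_contamQuot₂ hg hp hgr hgr' (densityLaw f)).mono fun x h => by
      simp only [pif₂, h.limUnder_eq, mul_pow, neg_sq]
  rw [asv, integral_congr_ae h₁, integral_congr_ae h₂, integral_const_mul, integral_const_mul,
    integral_iqrInfluence_sq hf hp hfr hfr', integral_iqrInfluence_sq hg hp hgr hgr']

end Ratio

/-! ### Location-scale families -/

section LocScale

variable {f : ℝ → ℝ} {s : ℝ}

theorem densityLaw_locScaleDensity (hf : IsProbDensity f) (m : ℝ) (hs : 0 < s) :
    densityLaw (locScaleDensity f m s) = (densityLaw f).map (fun y => m + s * y) := by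
  have hφ : Measurable fun y : ℝ => m + s * y := by fun_prop
  have hvol : (volume : Measure ℝ).map (fun y => m + s * y) = ENNReal.ofReal s⁻¹ • volume := by
    have h := Real.map_volume_mul_left hs.ne'
    rw [abs_of_pos (inv_pos.2 hs)] at h
    have hc : (fun y : ℝ => m + s * y) = (fun y => m + y) ∘ fun y => s * y := rfl
    rw [hc, ← Measure.map_map (by fun_prop) (by fun_prop), h, Measure.map_smul,
      map_add_left_eq_self]
  have hψ : Measurable fun x : ℝ => ENNReal.ofReal (f ((x - m) / s)) :=
    (hf.measurable.comp (by fun_prop)).ennreal_ofReal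
  ext A hA
  rw [Measure.map_apply hφ hA, densityLaw, densityLaw, withDensity_apply _ hA,
    withDensity_apply _ (hφ hA)]
  have h := setLIntegral_map (μ := volume) hA hψ hφ
  rw [hvol, Measure.restrict_smul, lintegral_smul_measure, smul_eq_mul,
    ← lintegral_const_mul _ hψ] at h
  simp only [← ENNReal.ofReal_mul (inv_pos.2 hs).le] at h
  simp only [locScaleDensity, h, add_sub_cancel_left, mul_div_cancel_left₀ _ hs.ne']

theorem IsProbDensity.locScale (hf : IsProbDensity f) (m : ℝ) (hs : 0 < s) :
    IsProbDensity (locScaleDensity f m s) where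
  measurable := (hf.measurable.comp (by fun_prop)).const_mul _
  nonneg x := mul_nonneg (inv_pos.2 hs).le (hf.nonneg _)
  lintegral_eq_one := by
    have := hf.isProbabilityMeasure
    have h := congrArg (fun μ : Measure ℝ => μ univ) (densityLaw_locScaleDensity hf m hs)
    simp only [densityLaw, withDensity_apply _ MeasurableSet.univ, Measure.restrict_univ] at h
    rw [h, ← densityLaw, Measure.map_apply (by fun_prop) MeasurableSet.univ, preimage_univ,
      measure_univ]

theorem cdf_locScale (hf : IsProbDensity f) (m : ℝ) (hs : 0 < s) (x : ℝ) :
    cdf (densityLaw (locScaleDensity f m s)) x = cdf (densityLaw f) ((x - m) / s) := by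
  have := hf.isProbabilityMeasure
  have := (hf.locScale m hs).isProbabilityMeasure
  rw [cdf_eq_real, cdf_eq_real, measureReal_def, measureReal_def,
    densityLaw_locScaleDensity hf m hs, Measure.map_apply (by fun_prop) measurableSet_Iic]
  congr 2
  ext y
  rw [mem_preimage, mem_Iic, mem_Iic, le_div_iff₀ hs, le_sub_iff_add_le', mul_comm y]

variable {p : ℝ}

theorem quantile_locScale (hf : IsProbDensity f) (m : ℝ) (hs : 0 < s) (hp₀ : 0 < p) (hp₁ : p < 1)
    (hr : RegularAtQuantile f p) :
    quantile p (densityLaw (locScaleDensity f m s)) = m + s * quantile p (densityLaw f) := by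
  refine le_antisymm (quantile_le hp₀ ?_) (le_quantile hp₁ fun y hy => ?_)
  · rw [cdf_locScale hf m hs, add_sub_cancel_left, mul_div_cancel_left₀ _ hs.ne',
      hf.cdf_quantile_eq hp₀ hp₁ hr]
  · rw [cdf_locScale hf m hs] at hy
    have h := quantile_le hp₀ hy
    rw [le_div_iff₀ hs] at h
    linarith

theorem locScaleDensity_quantile (hf : IsProbDensity f) (m : ℝ) (hs : 0 < s) (hp₀ : 0 < p)
    (hp₁ : p < 1) (hr : RegularAtQuantile f p) :
    locScaleDensity f m s (quantile p (densityLaw (locScaleDensity f m s))) =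
      s⁻¹ * f (quantile p (densityLaw f)) := by
  rw [quantile_locScale hf m hs hp₀ hp₁ hr, locScaleDensity, add_sub_cancel_left,
    mul_div_cancel_left₀ _ hs.ne']

theorem RegularAtQuantile.locScale (hf : IsProbDensity f) (m : ℝ) (hs : 0 < s) (hp₀ : 0 < p)
    (hp₁ : p < 1) (hr : RegularAtQuantile f p) : RegularAtQuantile (locScaleDensity f m s) p := by
  refine ⟨?_, ?_⟩
  · rw [locScaleDensity_quantile hf m hs hp₀ hp₁ hr]
    exact mul_pos (inv_pos.2 hs) hr.1
  · rw [quantile_locScale hf m hs hp₀ hp₁ hr]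
    refine continuousAt_const.mul (ContinuousAt.comp (g := f) ?_ (by fun_prop))
    rw [add_sub_cancel_left, mul_div_cancel_left₀ _ hs.ne']
    exact hr.2

theorem quantileDensity_locScale (hf : IsProbDensity f) (m : ℝ) (hs : 0 < s) (hp₀ : 0 < p)
    (hp₁ : p < 1) (hr : RegularAtQuantile f p) :
    quantileDensity (locScaleDensity f m s) p = s * quantileDensity f p := by
  rw [quantileDensity, locScaleDensity_quantile hf m hs hp₀ hp₁ hr, quantileDensity]
  field_simp

theorem iqr_locScale (hf : IsProbDensity f) (m : ℝ) (hs : 0 < s) (hp : p ∈ Ioo (0 : ℝ) (1 / 2))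
    (hr : RegularAtQuantile f p) (hr' : RegularAtQuantile f (1 - p)) :
    iqr p (densityLaw (locScaleDensity f m s)) = s * iqr p (densityLaw f) := by
  rw [iqr, iqr, quantile_locScale hf m hs hp.1 (by linarith [hp.2]) hr,
    quantile_locScale hf m hs (by linarith [hp.2]) (by linarith [hp.1]) hr']
  ring

theorem iqrVariance_locScale (hf : IsProbDensity f) (m : ℝ) (hs : 0 < s)
    (hp : p ∈ Ioo (0 : ℝ) (1 / 2))
    (hr : RegularAtQuantile f p) (hr' : RegularAtQuantile f (1 - p)) :
    iqrVariance (locScaleDensity f m s) p = s ^ 2 * iqrVariance f p := by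
  rw [iqrVariance, iqrVariance, quantileDensity_locScale hf m hs hp.1 (by linarith [hp.2]) hr,
    quantileDensity_locScale hf m hs (by linarith [hp.2]) (by linarith [hp.1]) hr']
  ring

/-- The asymptotic variance separates into a positive factor carrying the scales and a function of
`p` determined by the standard density alone. -/
theorem asv_sqIQRRatio_locScale (hf : IsProbDensity f) {n₁ n₂ : ℕ} (hn₁ : 0 < n₁)
    (hn₂ : 0 < n₂) (μ₁ μ₂ : ℝ) {σ₁ σ₂ : ℝ} (hσ₁ : 0 < σ₁) (hσ₂ : 0 < σ₂)
    (hp : p ∈ Ioo (0 : ℝ) (1 / 2))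
    (hr : RegularAtQuantile f p) (hr' : RegularAtQuantile f (1 - p)) :
    asv (sqIQRRatio p) (densityLaw (locScaleDensity f μ₁ σ₁))
        (densityLaw (locScaleDensity f μ₂ σ₂)) n₁ n₂ =
      σ₁ ^ 4 / σ₂ ^ 4 * (4 * iqrVariance f p /
        ((n₁ : ℝ) / (n₁ + n₂) * (1 - (n₁ : ℝ) / (n₁ + n₂)) * iqr p (densityLaw f) ^ 2)) := by
  have hp₁ : p < 1 := by linarith [hp.2]
  have hq₀ : 0 < 1 - p := by linarith
  have hq₁ : 1 - p < 1 := by linarith [hp.1]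
  rw [asv_sqIQRRatio (hf.locScale μ₁ hσ₁) (hf.locScale μ₂ hσ₂) hp
    (hr.locScale hf μ₁ hσ₁ hp.1 hp₁) (hr'.locScale hf μ₁ hσ₁ hq₀ hq₁)
    (hr.locScale hf μ₂ hσ₂ hp.1 hp₁) (hr'.locScale hf μ₂ hσ₂ hq₀ hq₁),
    iqr_locScale hf μ₁ hσ₁ hp hr hr', iqr_locScale hf μ₂ hσ₂ hp hr hr',
    iqrVariance_locScale hf μ₁ hσ₁ hp hr hr', iqrVariance_locScale hf μ₂ hσ₂ hp hr hr']
  have hI : iqr p (densityLaw f) ≠ 0 :=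
    (sub_pos.2 (hf.quantile_lt_quantile_one_sub hp hr hr')).ne'
  have h₁ : (0 : ℝ) < n₁ := Nat.cast_pos.2 hn₁
  have h₂ : (0 : ℝ) < n₂ := Nat.cast_pos.2 hn₂
  have hw : 1 - (n₁ : ℝ) / (n₁ + n₂) = n₂ / (n₁ + n₂) := by field_simp; ring
  rw [hw]
  field_simp
  ring

end LocScale

end

theorem corollary1 (f : ℝ → ℝ) (hf : IsProbDensity f) (n₁ n₂ : ℕ) (hn₁ : 0 < n₁) (hn₂ : 0 < n₂) :
    (∀ μ₁ μ₂ σ₁ σ₂ : ℝ, 0 < σ₁ → 0 < σ₂ →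
      ∀ p ∈ Set.Ioo (0 : ℝ) (1 / 2), RegularAtQuantile f p → RegularAtQuantile f (1 - p) →
        ∀ w₁ : ℝ, w₁ = (n₁ : ℝ) / (n₁ + n₂) →
          HasASV (sqIQRRatio p) (densityLaw (locScaleDensity f μ₁ σ₁))
            (densityLaw (locScaleDensity f μ₂ σ₂)) ∧
          asv (sqIQRRatio p) (densityLaw (locScaleDensity f μ₁ σ₁))
              (densityLaw (locScaleDensity f μ₂ σ₂)) n₁ n₂ =
            4 * p * (σ₁ ^ 4 / σ₂ ^ 4) *
              ((quantileDensity f p ^ 2 + quantileDensity f (1 - p) ^ 2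
                  - p * (quantileDensity f p + quantileDensity f (1 - p)) ^ 2) /
                (w₁ * (1 - w₁) *
                  (quantile (1 - p) (densityLaw f) - quantile p (densityLaw f)) ^ 2))) ∧
    (∀ S : Set ℝ, S ⊆ Set.Ioo (0 : ℝ) (1 / 2) →
      (∀ p ∈ S, RegularAtQuantile f p ∧ RegularAtQuantile f (1 - p)) →
      ∀ μ₁ μ₂ σ₁ σ₂ μ₁' μ₂' σ₁' σ₂' : ℝ, 0 < σ₁ → 0 < σ₂ → 0 < σ₁' → 0 < σ₂' →
        ∀ p ∈ S,
          (IsMinOn (fun t => asv (sqIQRRatio t) (densityLaw (locScaleDensity f μ₁ σ₁))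
              (densityLaw (locScaleDensity f μ₂ σ₂)) n₁ n₂) S p ↔
            IsMinOn (fun t => asv (sqIQRRatio t) (densityLaw (locScaleDensity f μ₁' σ₁'))
              (densityLaw (locScaleDensity f μ₂' σ₂')) n₁ n₂) S p)) := by
  refine ⟨?_, ?_⟩
  · rintro μ₁ μ₂ σ₁ σ₂ hσ₁ hσ₂ p hp hr hr' w₁ rfl
    have hp₁ : p < 1 := by linarith [hp.2]
    have hq₀ : 0 < 1 - p := by linarith
    have hq₁ : 1 - p < 1 := by linarith [hp.1]
    refine ⟨hasASV_sqIQRRatio (hf.locScale μ₁ hσ₁) (hf.locScale μ₂ hσ₂) hp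
      (hr.locScale hf μ₁ hσ₁ hp.1 hp₁) (hr'.locScale hf μ₁ hσ₁ hq₀ hq₁)
      (hr.locScale hf μ₂ hσ₂ hp.1 hp₁) (hr'.locScale hf μ₂ hσ₂ hq₀ hq₁), ?_⟩
    rw [asv_sqIQRRatio_locScale hf hn₁ hn₂ μ₁ μ₂ hσ₁ hσ₂ hp hr hr', iqrVariance, iqr]
    ring
  · intro S hS hreg μ₁ μ₂ σ₁ σ₂ μ₁' μ₂' σ₁' σ₂' hσ₁ hσ₂ hσ₁' hσ₂' p hp
    have key : ∀ m₁ m₂ s₁ s₂ : ℝ, 0 < s₁ → 0 < s₂ →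
        (IsMinOn (fun t => asv (sqIQRRatio t) (densityLaw (locScaleDensity f m₁ s₁))
            (densityLaw (locScaleDensity f m₂ s₂)) n₁ n₂) S p ↔
          IsMinOn (fun t => 4 * iqrVariance f t / ((n₁ : ℝ) / (n₁ + n₂) *
            (1 - (n₁ : ℝ) / (n₁ + n₂)) * iqr t (densityLaw f) ^ 2)) S p) := by
      intro m₁ m₂ s₁ s₂ hs₁ hs₂
      have hc : 0 < s₁ ^ 4 / s₂ ^ 4 := by positivity
      simp only [isMinOn_iff]
      refine forall₂_congr fun t ht => ?_
      rw [asv_sqIQRRatio_locScale hf hn₁ hn₂ m₁ m₂ hs₁ hs₂ (hS hp) (hreg p hp).1 (hreg p hp).2,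
        asv_sqIQRRatio_locScale hf hn₁ hn₂ m₁ m₂ hs₁ hs₂ (hS ht) (hreg t ht).1 (hreg t ht).2,
        mul_le_mul_iff_right₀ hc]
    rw [key μ₁ μ₂ σ₁ σ₂ hσ₁ hσ₂, key μ₁' μ₂' σ₁' σ₂' hσ₁' hσ₂']
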